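/- For $u,v\in\mathbb Z^2$ and real $\rho>0$ let $B_\rho(u)=\{w\in\mathbb Z^2 : d(u,w)\le \rho\}$, where $d$ is the Euclidean distance, and for $r>0$, $\Delta\ge 0$ let $$S_{r,\Delta}(u,v)=\bigl(B_r(u)\setminus B_{r+\Delta}(v)\bigr)\cup\bigl(B_r(v)\setminus B_{r+\Delta}(u)\bigr).$$ A set $C\subseteq\mathbb Z^2$ is an $(r,\Delta)$-identifying code if $B_r(u)\cap C\ne\emptyset$ for every $u\in\mathbb Z^2$ and $S_{r,\Delta}(u,v)\cap C\neq\emptyset$ for all distinct $u,v\in\mathbb Z^2$. The density of $C$ is $D(C)=\limsup_{n\to\infty}|C\cap Q_n|/|Q_n|$ with $Q_n=\{(x,y)\in\mathbb Z^2: |x|\le n,\ |y|\le n\}$, and an $(r,\Delta)$-identifying code is optimal if no $(r,\Delta)$-identifying code has lower density. Let $k$ be an odd integer not divisible by $3$, let $r=2k^2+1$, and let $\Delta$ be given by $r+\Delta=\sqrt{r^2+2r-3}$. Then the horizontal pattern $S_{r,\Delta}((0,0),(-1,0))$ has exactly $6$ elements, and it intersects all the diagonal lines modulo $6$: for every $i\in\{0,1,\dots,5\}$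 it contains an element $(x,y)$ with $y-x\equiv i \pmod 6$; equivalently, its six elements lie on distinct diagonal lines modulo $6$. Moreover, there is a constant $r_0$ such that, for every such $k$ with $r=2k^2+1\ge r_0$, there is an optimal $(r,\Delta)$-identifying code, and it has density $\frac16$. -/

import Mathlib

noncomputable section

namespace TolerantId

/-- The Euclidean distance between two points of the square grid. -/
def eDist (u v : ℤ × ℤ) : ℝ :=
  Real.sqrt (((u.1 : ℝ) - (v.1 : ℝ)) ^ 2 + ((u.2 : ℝ) - (v.2 : ℝ)) ^ 2)

/-- The Euclidean ball of radius `r` around `u` in the square grid. -/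
def ball (r : ℝ) (u : ℤ × ℤ) : Set (ℤ × ℤ) :=
  {v | eDist u v ≤ r}

/-- The vertices that separate `u` from `v` whatever the monitored areas are. -/
def sep (r Δ : ℝ) (u v : ℤ × ℤ) : Set (ℤ × ℤ) :=
  (ball r u \ ball (r + Δ) v) ∪ (ball r v \ ball (r + Δ) u)

/-- The horizontal pattern. -/
def horizontalPattern (r Δ : ℝ) : Set (ℤ × ℤ) :=
  sep r Δ (0, 0) (-1, 0)

/-- `(r, Δ)`-tolerant identifying codes. -/
def IsIdentifyingCode (r Δ : ℝ) (C : Set (ℤ × ℤ)) : Prop :=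
  (∀ u : ℤ × ℤ, (ball r u ∩ C).Nonempty) ∧
    ∀ u v : ℤ × ℤ, u ≠ v → (sep r Δ u v ∩ C).Nonempty

/-- The square `Q_n` of all `(x, y)` with `|x| ≤ n` and `|y| ≤ n`. -/
def square (n : ℕ) : Set (ℤ × ℤ) :=
  {p | |p.1| ≤ (n : ℤ) ∧ |p.2| ≤ (n : ℤ)}

/-- The (upper) density of a code; the sequence takes values in `[0, 1]`. -/
def density (C : Set (ℤ × ℤ)) : ℝ :=
  Filter.limsup
    (fun n : ℕ => ((C ∩ square n).ncard : ℝ) / ((square n).ncard : ℝ)) Filter.atTop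

/-- An `(r, Δ)`-identifying code is optimal if no `(r, Δ)`-identifying code has lower density. -/
def IsOptimalCode (r Δ : ℝ) (C : Set (ℤ × ℤ)) : Prop :=
  IsIdentifyingCode r Δ C ∧
    ∀ C' : Set (ℤ × ℤ), IsIdentifyingCode r Δ C' → density C ≤ density C'

/-- `U` intersects all the diagonal lines modulo `s`. -/
def IntersectsAllDiagonals (U : Set (ℤ × ℤ)) (s : ℕ) : Prop :=
  ∀ i : ℤ, 0 ≤ i → i < (s : ℤ) → ∃ p ∈ U, p.2 - p.1 ≡ i [ZMOD (s : ℤ)]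

/-- Distinct elements of `U` lie on distinct diagonal lines modulo `s`. -/
def OnDistinctDiagonals (U : Set (ℤ × ℤ)) (s : ℕ) : Prop :=
  ∀ p ∈ U, ∀ q ∈ U, p.2 - p.1 ≡ q.2 - q.1 [ZMOD (s : ℤ)] → p = q

end TolerantId

end

namespace TolerantId

/-! Both bounds come from the separating sets S(u,v). A code meets every translate of the horizontal
pattern, which has six points; covering a square by six shifted copies of the code gives density at
least 1/6 (`inv_card_le_density`). Conversely, every sixth diagonal y - x ≡ 0 mod 6 has density 1/6,
and it is a code once every S(u,v) meets all six classes of y - x (`exists_separates`). By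
translation only v - u = (a, b) matters: a unit step uses the pattern itself, a coordinate of size
at least 2 uses six points in a row near an extreme point of the circle, and (±1, ±1) uses a lattice
line almost tangent to the circle in the direction (3, 4). -/

/-- Separation of `(0, 0)` from `(a, b)` by `(p, q)`, in integer form, for
`(r + Δ) ^ 2 = r ^ 2 + 2 * r - 3`. -/
def Separates (r a b p q : ℤ) : Prop :=
  (p ^ 2 + q ^ 2 ≤ r ^ 2 ∧ r ^ 2 + 2 * r - 3 < (p - a) ^ 2 + (q - b) ^ 2) ∨
    ((p - a) ^ 2 + (q - b) ^ 2 ≤ r ^ 2 ∧ r ^ 2 + 2 * r - 3 < p ^ 2 + q ^ 2)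

theorem Separates.swap {r a b p q : ℤ} (h : Separates r a b p q) : Separates r b a q p := by
  unfold Separates at *
  simpa only [add_comm] using h

theorem Separates.neg {r a b p q : ℤ} (h : Separates r a b p q) :
    Separates r (-a) (-b) (p - a) (q - b) := by
  unfold Separates at *
  simpa only [sub_neg_eq_add, sub_add_cancel] using h.symm

theorem eDist_le_intCast_iff {r : ℤ} (hr : 0 ≤ r) (u w : ℤ × ℤ) :
    eDist u w ≤ (r : ℝ) ↔ (w.1 - u.1) ^ 2 + (w.2 - u.2) ^ 2 ≤ r ^ 2 := by
  have hr' : (0 : ℝ) ≤ r := by exact_mod_cast hr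
  rw [eDist, Real.sqrt_le_left hr', ← Int.cast_le (R := ℝ)]
  push_cast
  rw [sub_sq_comm (u.1 : ℝ), sub_sq_comm (u.2 : ℝ)]

theorem eDist_le_sqrt_iff {m : ℤ} (hm : 0 ≤ m) (u w : ℤ × ℤ) :
    eDist u w ≤ Real.sqrt m ↔ (w.1 - u.1) ^ 2 + (w.2 - u.2) ^ 2 ≤ m := by
  have hm' : (0 : ℝ) ≤ m := by exact_mod_cast hm
  rw [eDist, Real.sqrt_le_sqrt_iff hm', ← Int.cast_le (R := ℝ)]
  push_cast
  rw [sub_sq_comm (u.1 : ℝ), sub_sq_comm (u.2 : ℝ)]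

theorem mem_sep_iff {r : ℤ} {Δ : ℝ} (hr : 1 ≤ r)
    (h : (r : ℝ) + Δ = Real.sqrt ((r : ℝ) ^ 2 + 2 * r - 3)) (u v w : ℤ × ℤ) :
    w ∈ sep r Δ u v ↔
      Separates r (v.1 - u.1) (v.2 - u.2) (w.1 - u.1) (w.2 - u.2) := by
  have hm : (0 : ℤ) ≤ r ^ 2 + 2 * r - 3 := by nlinarith
  have h' : (r : ℝ) + Δ = Real.sqrt ((r ^ 2 + 2 * r - 3 : ℤ) : ℝ) := by
    rw [h]; push_cast; rfl
  simp only [sep, ball, Separates, Set.mem_union, Set.mem_sdiff, Set.mem_ofPred_eq, h',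
    eDist_le_sqrt_iff hm, eDist_le_intCast_iff (zero_le_one.trans hr), not_le,
    sub_sub_sub_cancel_right]

/-! ### The horizontal pattern -/

/-- The six points of the horizontal pattern. -/
def patternPoints (r k : ℤ) : Finset (ℤ × ℤ) :=
  {(r, 0), (r - 1, 2 * k), (r - 1, -(2 * k)), (-1 - r, 0), (-r, 2 * k), (-r, -(2 * k))}

theorem eq_of_lune {r k p q : ℤ} (hk : Odd k) (hr : r = 2 * k ^ 2 + 1)
    (h₁ : p ^ 2 + q ^ 2 ≤ r ^ 2) (h₂ : r ^ 2 + 2 * r - 3 < (p + 1) ^ 2 + q ^ 2) :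
    (p = r ∧ q = 0) ∨ (p = r - 1 ∧ (q = 2 * k ∨ q = -(2 * k))) := by
  have hr0 : 1 ≤ r := by nlinarith [sq_nonneg k]
  have hp1 : r - 1 ≤ p := by nlinarith
  have hp2 : p ≤ r := by nlinarith [sq_nonneg q]
  obtain rfl | rfl : p = r ∨ p = r - 1 := by omega
  · left
    refine ⟨rfl, ?_⟩
    have : q ^ 2 ≤ 0 := by linarith
    nlinarith
  · right
    refine ⟨rfl, ?_⟩
    have hq1 : q ^ 2 ≤ 4 * k ^ 2 + 1 := by nlinarith
    have hq2 : 4 * k ^ 2 ≤ q ^ 2 := by nlinarith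
    obtain hq | hq : q ^ 2 = 4 * k ^ 2 ∨ q ^ 2 = 4 * k ^ 2 + 1 := by omega
    · exact sq_eq_sq_iff_eq_or_eq_neg.1 (by rw [hq]; ring)
    -- For odd k, 4k² + 1 ≡ 5 mod 8 is not a square.
    · obtain ⟨j, rfl⟩ := hk
      exfalso
      rcases Int.even_or_odd q with ⟨m, rfl⟩ | hodd
      · ring_nf at hq
        omega
      · have h8 := Int.eight_dvd_sq_sub_one_of_odd hodd
        ring_nf at hq h8
        omega

theorem separates_unit_iff {r k : ℤ} (hk : Odd k) (hr : r = 2 * k ^ 2 + 1) (p q : ℤ) :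
    Separates r (-1) 0 p q ↔ (p, q) ∈ patternPoints r k := by
  have hk2 : 1 ≤ k ^ 2 := by
    have : k ≠ 0 := by rintro rfl; simp at hk
    have := sq_pos_of_ne_zero this
    omega
  simp only [Separates, patternPoints, Finset.mem_insert, Finset.mem_singleton, Prod.mk.injEq]
  constructor
  · rintro (⟨h₁, h₂⟩ | ⟨h₁, h₂⟩)
    · have := eq_of_lune (p := p) (q := q) hk hr h₁ (by linarith)
      omega
    · have := eq_of_lune (p := -1 - p) (q := q) hk hr (by linarith) (by linarith)
      omega
  · rintro (⟨rfl, rfl⟩ | ⟨rfl, rfl⟩ | ⟨rfl, rfl⟩ | ⟨rfl, rfl⟩ | ⟨rfl, rfl⟩ | ⟨rfl, rfl⟩)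
    · left; constructor <;> nlinarith
    · left; constructor <;> nlinarith
    · left; constructor <;> nlinarith
    · right; constructor <;> nlinarith
    · right; constructor <;> nlinarith
    · right; constructor <;> nlinarith

theorem horizontalPattern_eq {r k : ℤ} {Δ : ℝ} (hk : Odd k) (hr : r = 2 * k ^ 2 + 1)
    (h : (r : ℝ) + Δ = Real.sqrt ((r : ℝ) ^ 2 + 2 * r - 3)) :
    horizontalPattern r Δ = patternPoints r k := by
  have hr1 : 1 ≤ r := by nlinarith [sq_nonneg k]
  ext ⟨p, q⟩
  simp [horizontalPattern, mem_sep_iff hr1 h, separates_unit_iff hk hr]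

/-- The residues of `k` and `r` modulo `6`. -/
theorem emod_six {r k : ℤ} (hk : Odd k) (hk3 : ¬ (3 : ℤ) ∣ k) (hr : r = 2 * k ^ 2 + 1) :
    r % 6 = 3 ∧ (k % 6 = 1 ∨ k % 6 = 5) := by
  have hk2 := Int.odd_iff.1 hk
  have hk6 : k % 6 = 1 ∨ k % 6 = 5 := by omega
  refine ⟨?_, hk6⟩
  rcases hk6 with h | h <;> simp [hr, pow_two, Int.add_emod, Int.mul_emod, h]

/-- Since r ≡ 3 and 2k ≡ ±2 mod 6, the classes of y - x are 3, {0, 2}, 4 and {1, 5}. -/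
theorem exists_mem_patternPoints {r k : ℤ} (hk : Odd k) (hk3 : ¬ (3 : ℤ) ∣ k)
    (hr : r = 2 * k ^ 2 + 1) (c : ℤ) :
    ∃ p ∈ patternPoints r k, p.2 - p.1 ≡ c [ZMOD 6] := by
  obtain ⟨h₁, h₂⟩ := emod_six hk hk3 hr
  simp only [patternPoints, Finset.mem_insert, Finset.mem_singleton, exists_eq_or_imp,
    exists_eq_left, Int.ModEq]
  omega

theorem card_patternPoints {r k : ℤ} (hk : Odd k) (hr : r = 2 * k ^ 2 + 1) :
    (patternPoints r k).card = 6 := by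
  have hk0 : k ≠ 0 := by rintro rfl; simp at hk
  have hr1 : 1 ≤ r := by nlinarith [sq_nonneg k]
  unfold patternPoints
  repeat rw [Finset.card_insert_of_notMem
    (by simp only [Finset.mem_insert, Finset.mem_singleton, Prod.mk.injEq]; omega)]
  rfl

theorem eq_of_mem_patternPoints {r k : ℤ} (hk : Odd k) (hk3 : ¬ (3 : ℤ) ∣ k)
    (hr : r = 2 * k ^ 2 + 1) {p q : ℤ × ℤ} (hp : p ∈ patternPoints r k)
    (hq : q ∈ patternPoints r k) (h : p.2 - p.1 ≡ q.2 - q.1 [ZMOD 6]) : p = q := by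
  obtain ⟨h₁, h₂⟩ := emod_six hk hk3 hr
  obtain ⟨p₁, p₂⟩ := p
  obtain ⟨q₁, q₂⟩ := q
  simp only [patternPoints, Finset.mem_insert, Finset.mem_singleton, Prod.mk.injEq,
    Int.ModEq] at *
  rcases hp with hp | hp | hp | hp | hp | hp <;>
  rcases hq with hq | hq | hq | hq | hq | hq <;> omega

/-! ### Separation for the other difference vectors -/

theorem exists_separates_of_two_le {r a b : ℤ} (hr : 19 ≤ r) (ha : 2 ≤ a) (c : ℤ) :
    ∃ p q, Separates r a b p q ∧ q - p ≡ c [ZMOD 6] := by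
  rcases le_total 0 b with hb | hb
  · obtain ⟨y, hy1, hy6, hy⟩ : ∃ y : ℤ, 1 ≤ y ∧ y ≤ 6 ∧ -y - (1 - r) ≡ c [ZMOD 6] :=
      ⟨(r - c - 2) % 6 + 1, by omega, by omega, by simp only [Int.ModEq]; omega⟩
    -- The point lies in the ball because y² ≤ 36 ≤ 2r - 1, which is where 19 ≤ r enters. The sign
    -- of y is opposite to that of b, so the vertical distance to (a, b) is at least y.
    refine ⟨1 - r, -y, Or.inl ⟨by nlinarith, ?_⟩, hy⟩
    have : (r + 1) ^ 2 ≤ (1 - r - a) ^ 2 := by nlinarith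
    nlinarith [mul_nonneg (by omega : 0 ≤ y) hb]
  · obtain ⟨y, hy1, hy6, hy⟩ : ∃ y : ℤ, 1 ≤ y ∧ y ≤ 6 ∧ y - (1 - r) ≡ c [ZMOD 6] :=
      ⟨(c - r) % 6 + 1, by omega, by omega, by simp only [Int.ModEq]; omega⟩
    refine ⟨1 - r, y, Or.inl ⟨by nlinarith, ?_⟩, hy⟩
    have : (r + 1) ^ 2 ≤ (1 - r - a) ^ 2 := by nlinarith
    nlinarith [mul_nonneg (by omega : 0 ≤ y) (neg_nonneg.2 hb)]

/-- Lattice points just inside the circle of radius `r`, near the direction `(3, 4)`. -/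
theorem exists_near_three_four {r : ℤ} (hr : 3000 ≤ r) (c : ℤ) :
    ∃ m : ℤ, m ≡ c [ZMOD 6] ∧
      (4 * m - (5 * r - 1)) ^ 2 + (5 * r - 1 - 3 * m) ^ 2 ≤ r ^ 2 ∧
      r ^ 2 + 2 * r - 3 <
        (4 * m - (5 * r - 1) + 1) ^ 2 + (5 * r - 1 - 3 * m + 1) ^ 2 := by
  -- With N = 5r - 1, the points (x, y) = (4m - N, N - 3m) run along 3x + 4y = N. Setting t = 4x -
  -- 3y = 25m - 7N gives 25(x² + y²) = N² + t², so t² + 1 ≤ 10r keeps the point inside; t ≤ 150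
  -- leaves room for six consecutive m.
  obtain ⟨m, hm, h₁, h₂⟩ : ∃ m : ℤ, m ≡ c [ZMOD 6] ∧ -25 ≤ 25 * m - 7 * (5 * r - 1) ∧
      25 * m - 7 * (5 * r - 1) ≤ 150 :=
    ⟨7 * (5 * r - 1) / 25 + (c - 7 * (5 * r - 1) / 25) % 6,
      by simp only [Int.ModEq]; omega, by omega, by omega⟩
  refine ⟨m, hm, ?_, ?_⟩ <;> nlinarith [mul_nonneg (sub_nonneg.2 h₁) (sub_nonneg.2 h₂)]

theorem exists_separates_one_one {r : ℤ} (hr : 3000 ≤ r) (c : ℤ) :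
    ∃ p q, Separates r 1 1 p q ∧ q - p ≡ c [ZMOD 6] := by
  obtain ⟨m, hm, h₁, h₂⟩ := exists_near_three_four hr (c + 2 * (5 * r - 1))
  refine ⟨-(4 * m - (5 * r - 1)), -(5 * r - 1 - 3 * m), Or.inl ⟨by linarith, by linarith⟩, ?_⟩
  simp only [Int.ModEq] at *
  omega

theorem exists_separates_one_neg_one {r : ℤ} (hr : 3000 ≤ r) (c : ℤ) :
    ∃ p q, Separates r 1 (-1) p q ∧ q - p ≡ c [ZMOD 6] := by
  obtain ⟨m, hm, h₁, h₂⟩ := exists_near_three_four hr c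
  refine ⟨-(4 * m - (5 * r - 1)), 5 * r - 1 - 3 * m, Or.inl ⟨by linarith, by linarith⟩, ?_⟩
  simp only [Int.ModEq] at *
  omega

/-- Reflection in the main diagonal negates y - x, hence permutes the classes. -/
theorem exists_separates_swap {r a b : ℤ}
    (h : ∀ c, ∃ p q, Separates r a b p q ∧ q - p ≡ c [ZMOD 6]) (c : ℤ) :
    ∃ p q, Separates r b a p q ∧ q - p ≡ c [ZMOD 6] := by
  obtain ⟨p, q, hs, hc⟩ := h (-c)
  refine ⟨q, p, hs.swap, ?_⟩
  simp only [Int.ModEq] at *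
  omega

/-- Recentring at (a, b) exchanges the two points and shifts y - x by a - b. -/
theorem exists_separates_neg {r a b : ℤ}
    (h : ∀ c, ∃ p q, Separates r a b p q ∧ q - p ≡ c [ZMOD 6]) (c : ℤ) :
    ∃ p q, Separates r (-a) (-b) p q ∧ q - p ≡ c [ZMOD 6] := by
  obtain ⟨p, q, hs, hc⟩ := h (c + b - a)
  refine ⟨p - a, q - b, hs.neg, ?_⟩
  simp only [Int.ModEq] at *
  omega

theorem exists_separates {r k : ℤ} (hk : Odd k) (hk3 : ¬ (3 : ℤ) ∣ k)
    (hr : r = 2 * k ^ 2 + 1) (hr0 : 3000 ≤ r) {a b : ℤ} (hab : ¬ (a = 0 ∧ b = 0)) :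
    ∀ c, ∃ p q, Separates r a b p q ∧ q - p ≡ c [ZMOD 6] := by
  have large : ∀ a b : ℤ, 2 ≤ a ∨ a ≤ -2 →
      ∀ c, ∃ p q, Separates r a b p q ∧ q - p ≡ c [ZMOD 6] := by
    rintro a b (ha | ha)
    · exact exists_separates_of_two_le (by omega) ha
    · simpa using exists_separates_neg
        (exists_separates_of_two_le (a := -a) (b := -b) (by omega : 19 ≤ r) (by omega))
  have unit : ∀ c, ∃ p q, Separates r (-1) 0 p q ∧ q - p ≡ c [ZMOD 6] := fun c => by
    obtain ⟨p, hp, hc⟩ := exists_mem_patternPoints hk hk3 hr c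
    exact ⟨p.1, p.2, (separates_unit_iff hk hr _ _).2 hp, hc⟩
  have unit' : ∀ c, ∃ p q, Separates r 1 0 p q ∧ q - p ≡ c [ZMOD 6] := by
    simpa using exists_separates_neg unit
  by_cases ha : 2 ≤ a ∨ a ≤ -2
  · exact large a b ha
  by_cases hb : 2 ≤ b ∨ b ≤ -2
  · exact exists_separates_swap (large b a hb)
  obtain rfl | rfl | rfl : a = -1 ∨ a = 0 ∨ a = 1 := by omega
  · obtain rfl | rfl | rfl : b = -1 ∨ b = 0 ∨ b = 1 := by omega
    · exact exists_separates_neg (exists_separates_one_one hr0)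
    · exact unit
    · exact exists_separates_swap (exists_separates_one_neg_one hr0)
  · obtain rfl | rfl : b = -1 ∨ b = 1 := by omega
    · exact exists_separates_swap unit
    · exact exists_separates_swap unit'
  · obtain rfl | rfl | rfl : b = -1 ∨ b = 0 ∨ b = 1 := by omega
    · exact exists_separates_one_neg_one hr0
    · exact unit'
    · exact exists_separates_one_one hr0

/-! ### The diagonal code -/

/-- The code made of every sixth diagonal line. -/
def diagonalCode : Set (ℤ × ℤ) :=
  {p | (6 : ℤ) ∣ p.2 - p.1}

theorem isIdentifyingCode_diagonalCode {r k : ℤ} {Δ : ℝ} (hk : Odd k) (hk3 : ¬ (3 : ℤ) ∣ k)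
    (hr : r = 2 * k ^ 2 + 1) (hr0 : 3000 ≤ r)
    (h : (r : ℝ) + Δ = Real.sqrt ((r : ℝ) ^ 2 + 2 * r - 3)) :
    IsIdentifyingCode r Δ diagonalCode := by
  constructor
  · intro u
    refine ⟨(u.1, u.2 + (u.1 - u.2) % 6), ?_, ?_⟩
    · have h0 : 0 ≤ (u.1 - u.2) % 6 := by omega
      have h6 : (u.1 - u.2) % 6 ≤ 6 := by omega
      simp only [ball, Set.mem_ofPred_eq]
      rw [eDist_le_intCast_iff (by omega)]
      simp only [sub_self, add_sub_cancel_left]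
      nlinarith
    · simp only [diagonalCode, Set.mem_ofPred_eq]
      omega
  · intro u v huv
    have hd : ¬ (v.1 - u.1 = 0 ∧ v.2 - u.2 = 0) := fun hd =>
      huv (Prod.ext (by omega) (by omega))
    obtain ⟨p, q, hs, hc⟩ := exists_separates hk hk3 hr hr0 hd (u.1 - u.2)
    refine ⟨(u.1 + p, u.2 + q), ?_, ?_⟩
    · rw [mem_sep_iff (by omega) h]
      simpa only [add_sub_cancel_left] using hs
    · simp only [diagonalCode, Set.mem_ofPred_eq]
      simp only [Int.ModEq] at hc
      omega

/-! ### Density bounds -/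

theorem square_eq (n : ℕ) :
    square n = (Finset.Icc (-(n : ℤ)) n ×ˢ Finset.Icc (-(n : ℤ)) n : Finset (ℤ × ℤ)) := by
  ext p
  simp [square, abs_le, Prod.le_def]
  tauto

theorem finite_square (n : ℕ) : (square n).Finite := by
  rw [square_eq]
  exact Finset.finite_toSet _

theorem ncard_square (n : ℕ) : (square n).ncard = (2 * n + 1) ^ 2 := by
  rw [square_eq, Set.ncard_coe_finset, Finset.card_product, Int.card_Icc, sq]
  congr 1 <;> omega

/-- A code meeting every translate of a finite set `F` has at least `|Q_n| / |F|` points in a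
slightly larger square. -/
theorem ncard_square_le_of_forall_exists {C : Set (ℤ × ℤ)} {F : Finset (ℤ × ℤ)} {M : ℕ}
    (hF : ∀ s ∈ F, s ∈ square M) (hC : ∀ u : ℤ × ℤ, ∃ s ∈ F, u + s ∈ C) (n : ℕ) :
    (2 * n + 1) ^ 2 ≤ F.card * (C ∩ square (n + M)).ncard := by
  classical
  have hfin : (C ∩ square (n + M)).Finite := (finite_square _).inter_of_right _
  rw [← ncard_square, Set.ncard_eq_toFinset_card _ (finite_square n),
    Set.ncard_eq_toFinset_card _ hfin]
  have hsub : (finite_square n).toFinset ⊆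
      F.biUnion fun s => hfin.toFinset.image fun w => w - s := by
    intro u hu
    obtain ⟨s, hs, hus⟩ := hC u
    simp only [Finset.mem_biUnion, Finset.mem_image, Set.Finite.mem_toFinset] at hu ⊢
    refine ⟨s, hs, u + s, ⟨hus, ?_⟩, add_sub_cancel_right u s⟩
    have := hF s hs
    simp only [square, Set.mem_ofPred_eq, abs_le, Prod.fst_add, Prod.snd_add] at *
    push_cast
    omega
  exact (Finset.card_le_card hsub).trans
    (Finset.card_biUnion_le_card_mul _ _ _ fun s _ => Finset.card_image_le)

theorem density_ratio_le_one (C : Set (ℤ × ℤ)) (n : ℕ) :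
    ((C ∩ square n).ncard : ℝ) / ((square n).ncard : ℝ) ≤ 1 := by
  refine div_le_one_of_le₀ ?_ (Nat.cast_nonneg _)
  exact_mod_cast Set.ncard_le_ncard Set.inter_subset_right (finite_square n)

theorem tendsto_ratio_affine (b c : ℝ) :
    Filter.Tendsto (fun n : ℕ => (2 * (n : ℝ) + b) / (2 * (n : ℝ) + c)) Filter.atTop
      (nhds 1) := by
  have h2 : Filter.Tendsto (fun n : ℕ => 2 * (n : ℝ) + c) Filter.atTop Filter.atTop :=
    Filter.tendsto_atTop_add_const_right _ _
      (tendsto_natCast_atTop_atTop.const_mul_atTop two_pos)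
  have h1 : Filter.Tendsto (fun n : ℕ => 1 + (b - c) / (2 * (n : ℝ) + c)) Filter.atTop
      (nhds (1 + 0)) := (h2.const_div_atTop (b - c)).const_add 1
  rw [add_zero] at h1
  refine h1.congr' ?_
  filter_upwards [h2.eventually_gt_atTop 0] with n hn
  field_simp
  ring

theorem inv_card_le_density {C : Set (ℤ × ℤ)} {F : Finset (ℤ × ℤ)}
    (hC : ∀ u : ℤ × ℤ, ∃ s ∈ F, u + s ∈ C) : 1 / (F.card : ℝ) ≤ density C := by
  obtain ⟨M, hM⟩ : ∃ M : ℕ, ∀ s ∈ F, s ∈ square M := by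
    refine ⟨F.sup fun s => max s.1.natAbs s.2.natAbs, fun s hs => ?_⟩
    have := Finset.le_sup (f := fun s : ℤ × ℤ => max s.1.natAbs s.2.natAbs) hs
    simp only [square, Set.mem_ofPred_eq, abs_le]
    simp only [max_le_iff] at this
    omega
  have hF : 0 < F.card := by
    obtain ⟨s, hs, -⟩ := hC 0
    exact Finset.card_pos.2 ⟨s, hs⟩
  have hF' : (0 : ℝ) < F.card := by exact_mod_cast hF
  have hlim : Filter.Tendsto (fun n : ℕ => 1 / (F.card : ℝ) *
      ((2 * (n : ℝ) + (1 - 2 * M)) / (2 * (n : ℝ) + 1)) ^ 2) Filter.atTop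
      (nhds (1 / (F.card : ℝ))) := by
    simpa using ((tendsto_ratio_affine (1 - 2 * M) 1).pow 2).const_mul (1 / (F.card : ℝ))
  rw [← hlim.limsup_eq]
  refine Filter.limsup_le_limsup ?_ hlim.isBoundedUnder_ge.isCoboundedUnder_le
    (Filter.isBoundedUnder_of ⟨1, density_ratio_le_one C⟩)
  filter_upwards [Filter.eventually_ge_atTop M] with n hn
  obtain ⟨m, rfl⟩ := Nat.exists_eq_add_of_le' hn
  have key : ((2 * (m : ℝ) + 1) ^ 2) ≤ F.card * ((C ∩ square (m + M)).ncard : ℝ) := by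
    exact_mod_cast ncard_square_le_of_forall_exists hM hC m
  rw [ncard_square, div_pow, ← mul_div_assoc]
  push_cast
  gcongr
  rw [one_div, inv_mul_le_iff₀ hF']
  rwa [show 2 * ((m : ℝ) + M) + (1 - 2 * M) = 2 * m + 1 by ring]

theorem card_filter_dvd_sub (n : ℕ) (x : ℤ) :
    6 * ((Finset.Icc (-(n : ℤ)) n).filter fun y => (6 : ℤ) ∣ y - x).card ≤ 2 * n + 7 := by
  have hcard : ((Finset.Icc (-(n : ℤ)) n).filter fun y => (6 : ℤ) ∣ y - x).card ≤
      (Finset.Icc 0 ((2 * (n : ℤ)) / 6)).card := by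
    -- Each block of six consecutive integers holds one point of the class.
    refine Finset.card_le_card_of_injOn (fun y => (y + n) / 6) ?_ ?_
    · intro y hy
      simp only [Finset.coe_filter, Set.mem_ofPred_eq, Finset.mem_Icc, Finset.coe_Icc,
        Set.mem_Icc] at *
      omega
    · intro y hy z hz hyz
      simp only [Finset.coe_filter, Set.mem_ofPred_eq, Finset.mem_Icc] at *
      omega
  rw [Int.card_Icc] at hcard
  omega

theorem ncard_diagonalCode_inter_square (n : ℕ) :
    6 * (diagonalCode ∩ square n).ncard ≤ (2 * n + 1) * (2 * n + 7) := by
  classical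
  have hset : diagonalCode ∩ square n =
      ((Finset.Icc (-(n : ℤ)) n).sigma fun x =>
        (Finset.Icc (-(n : ℤ)) n).filter fun y => (6 : ℤ) ∣ y - x).map
          (Equiv.sigmaEquivProd ℤ ℤ).toEmbedding := by
    ext ⟨x, y⟩
    simp [diagonalCode, square, abs_le, Equiv.sigmaEquivProd]
    tauto
  rw [hset, Set.ncard_coe_finset, Finset.card_map, Finset.card_sigma, Finset.mul_sum]
  refine (Finset.sum_le_card_nsmul _ _ (2 * n + 7) fun x _ => card_filter_dvd_sub n x).trans ?_
  rw [Int.card_Icc, smul_eq_mul]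
  gcongr
  omega

theorem density_diagonalCode_le : density diagonalCode ≤ 1 / 6 := by
  have hlim : Filter.Tendsto (fun n : ℕ => 1 / (6 : ℝ) *
      ((2 * (n : ℝ) + 7) / (2 * (n : ℝ) + 1))) Filter.atTop (nhds (1 / 6)) := by
    simpa using (tendsto_ratio_affine 7 1).const_mul (1 / (6 : ℝ))
  rw [← hlim.limsup_eq]
  refine Filter.limsup_le_limsup (Filter.Eventually.of_forall fun n => ?_)
    (Filter.isBoundedUnder_of (r := (· ≥ ·)) ⟨0, fun n => by positivity⟩).isCoboundedUnder_le
    hlim.isBoundedUnder_le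
  have key : 6 * ((diagonalCode ∩ square n).ncard : ℝ) ≤ (2 * n + 1) * (2 * n + 7) := by
    exact_mod_cast ncard_diagonalCode_inter_square n
  beta_reduce
  rw [ncard_square, div_le_iff₀ (by positivity)]
  push_cast
  have hn : (2 * (n : ℝ) + 1) ≠ 0 := by positivity
  field_simp
  linarith

theorem IsIdentifyingCode.one_sixth_le_density {r k : ℤ} {Δ : ℝ} {C : Set (ℤ × ℤ)}
    (hC : IsIdentifyingCode r Δ C) (hk : Odd k) (hr : r = 2 * k ^ 2 + 1)
    (h : (r : ℝ) + Δ = Real.sqrt ((r : ℝ) ^ 2 + 2 * r - 3)) : 1 / 6 ≤ density C := by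
  have hr1 : 1 ≤ r := by nlinarith [sq_nonneg k]
  have := inv_card_le_density (C := C) (F := patternPoints r k) fun u => by
    -- Separating u from its left neighbour puts a codeword in the pattern translated by u.
    obtain ⟨w, hw, hwC⟩ := hC.2 u (u + (-1, 0)) (by simp [Prod.ext_iff])
    rw [mem_sep_iff hr1 h] at hw
    refine ⟨w - u, (separates_unit_iff hk hr _ _).1 (by simpa using hw), by simpa using hwC⟩
  rwa [card_patternPoints hk hr] at this

end TolerantId

theorem mainTheorem4 :
    (∀ (k : ℤ) (r Δ : ℝ), Odd k → ¬ (3 : ℤ) ∣ k →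
      r = 2 * (k : ℝ) ^ 2 + 1 → r + Δ = Real.sqrt (r ^ 2 + 2 * r - 3) →
        (TolerantId.horizontalPattern r Δ).ncard = 6 ∧
        TolerantId.IntersectsAllDiagonals (TolerantId.horizontalPattern r Δ) 6 ∧
        TolerantId.OnDistinctDiagonals (TolerantId.horizontalPattern r Δ) 6) ∧
    (∃ r₀ : ℝ, ∀ (k : ℤ) (r Δ : ℝ), Odd k → ¬ (3 : ℤ) ∣ k →
      r = 2 * (k : ℝ) ^ 2 + 1 → r + Δ = Real.sqrt (r ^ 2 + 2 * r - 3) → r₀ ≤ r →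
        ∃ C : Set (ℤ × ℤ), TolerantId.IsOptimalCode r Δ C ∧ TolerantId.density C = 1 / 6) := by
  have hcast : ∀ (k : ℤ) (r : ℝ), r = 2 * (k : ℝ) ^ 2 + 1 →
      ∃ s : ℤ, s = 2 * k ^ 2 + 1 ∧ r = s := fun k r hr =>
    ⟨2 * k ^ 2 + 1, rfl, by rw [hr]; push_cast; rfl⟩
  refine ⟨fun k r Δ hk hk3 hr h => ?_, 3000, fun k r Δ hk hk3 hr h hr0 => ?_⟩
  · obtain ⟨s, hs, rfl⟩ := hcast k r hr
    rw [TolerantId.horizontalPattern_eq hk hs h]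
    refine ⟨?_, fun i _ _ => ?_, fun p hp q hq hpq => ?_⟩
    · rw [Set.ncard_coe_finset, TolerantId.card_patternPoints hk hs]
    · exact TolerantId.exists_mem_patternPoints hk hk3 hs i
    · exact TolerantId.eq_of_mem_patternPoints hk hk3 hs hp hq hpq
  · obtain ⟨s, hs, rfl⟩ := hcast k r hr
    have hcode := TolerantId.isIdentifyingCode_diagonalCode hk hk3 hs (by exact_mod_cast hr0) h
    have hdens : TolerantId.density TolerantId.diagonalCode = 1 / 6 :=
      le_antisymm TolerantId.density_diagonalCode_le (hcode.one_sixth_le_density hk hs h)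
    exact ⟨TolerantId.diagonalCode,
      ⟨hcode, fun C' hC' => hdens.le.trans (hC'.one_sixth_le_density hk hs h)⟩, hdens⟩
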